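/- Let $d_A,d_B\ge 1$, $n\ge 1$, and let $\rho_1,\dots,\rho_n$ be density operators (positive semidefinite, trace one) on $\mathbb{C}^{d_A}\otimes\mathbb{C}^{d_B}$ that form a full orthogonal set, that is, $\operatorname{tr}(\rho_i\rho_j)=0$ for all $i\neq j$ and $\sum_{i}\rho_i$ has full rank $d_Ad_B$. Assume that there is an index $i_0$ such that for every $i\neq i_0$ the state $\rho_i$ is a tensor product, $\rho_i=\sigma_i\otimes\tau_i$, where $\sigma_i$ acts on $\mathbb{C}^{d_A}$ and $\tau_i$ on $\mathbb{C}^{d_B}$; nothing is assumed of this kind about $\rho_{i_0}$. A finite LOCC protocol consists of finitely many rounds, in each of which one of the two parties applies a local quantum instrument to their system (possibly changing its finite dimension), chosen depending on the previously communicated outcomes, and communicates the (finitely valued) outcome to the other party; at the end a result in $\{1,\dots,n\}$ is declared as a function of the communicated outcomes. Such a protocol implements an $n$-outcome POVM on $\mathbb{C}^{d_A}\otimes\mathbb{C}^{d_B}$. A POVM $(M_1,\dots,M_n)$ is in finite LOCC if it is implemented exactly by a finite LOCC protocol, and it is in asymptotic LOCC if it is the limit of a sequence of POVMs each implemented by a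 finite LOCC protocol. The states can be discriminated with finite (respectively asymptotic) LOCC if there is a POVM $(M_1,\dots,M_n)$ in finite (respectively asymptotic) LOCC with $\operatorname{tr}(M_j\rho_i)=\delta_{ij}$ for all $i,j$. If $\rho_1,\dots,\rho_n$ can be discriminated with asymptotic LOCC, then they can be discriminated with finite LOCC. -/

import Mathlib

open scoped Kronecker Matrix ComplexOrder

namespace LOCC

/-- Operators on the bipartite space `ℂ^dA ⊗ ℂ^dB`, in the product basis. -/
abbrev BipOp (dA dB : ℕ) : Type := Matrix (Fin dA × Fin dB) (Fin dA × Fin dB) ℂ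

/-- A local quantum operation with a classical outcome (a quantum instrument) on `ℂ^d`, in Kraus
form. Outcome `k` occurs with the completely positive map `X ↦ ∑ j, K k j * X * (K k j)ᴴ`, whose
output system `ℂ^(outDim k)` is arbitrary and may depend on the outcome; the sum of these maps over
all outcomes is trace preserving. -/
structure Instrument (d : ℕ) where
  numOutcomes : ℕ
  outDim : Fin numOutcomes → ℕ
  numKraus : Fin numOutcomes → ℕ
  kraus : (k : Fin numOutcomes) → Fin (numKraus k) → Matrix (Fin (outDim k)) (Fin d) ℂ
  complete : ∑ k, ∑ j, (kraus k j)ᴴ * kraus k j = 1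

/-- Finite LOCC protocols for measuring a state of `ℂ^dA ⊗ ℂ^dB` with final result in `ι`: finite
trees. Either the parties stop and declare a result, or one of them applies a local instrument,
announces its outcome to the other, and they continue with a protocol that depends on it. -/
inductive Protocol (ι : Type) : ℕ → ℕ → Type
  | declare {dA dB : ℕ} (i : ι) : Protocol ι dA dB
  | alice {dA dB : ℕ} (I : Instrument dA)
      (next : (k : Fin I.numOutcomes) → Protocol ι (I.outDim k) dB) : Protocol ι dA dB
  | bob {dA dB : ℕ} (I : Instrument dB)
      (next : (k : Fin I.numOutcomes) → Protocol ι dA (I.outDim k)) : Protocol ι dA dB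

/-- The POVM that a protocol implements: on input `ρ`, the result is `i` with probability
`trace (P.povm i * ρ)`. -/
noncomputable def Protocol.povm {ι : Type} [DecidableEq ι] :
    {dA dB : ℕ} → Protocol ι dA dB → ι → BipOp dA dB
  | _, _, .declare i₀ => fun i => if i = i₀ then 1 else 0
  | _, dB, .alice I next => fun i => ∑ k, ∑ j,
      (I.kraus k j ⊗ₖ (1 : Matrix (Fin dB) (Fin dB) ℂ))ᴴ * (next k).povm i *
        (I.kraus k j ⊗ₖ (1 : Matrix (Fin dB) (Fin dB) ℂ))
  | dA, _, .bob I next => fun i => ∑ k, ∑ j,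
      ((1 : Matrix (Fin dA) (Fin dA) ℂ) ⊗ₖ I.kraus k j)ᴴ * (next k).povm i *
        ((1 : Matrix (Fin dA) (Fin dA) ℂ) ⊗ₖ I.kraus k j)

/-- The measurement `M` can be implemented exactly by a finite LOCC protocol. -/
def IsFiniteLOCC {ι : Type} [DecidableEq ι] {dA dB : ℕ} (M : ι → BipOp dA dB) : Prop :=
  ∃ P : Protocol ι dA dB, P.povm = M

/-- The measurement `M` can be implemented with vanishing error by a sequence of finite LOCC
protocols. -/
def IsAsymptoticLOCC {ι : Type} [DecidableEq ι] {dA dB : ℕ} (M : ι → BipOp dA dB) : Prop :=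
  ∃ P : ℕ → Protocol ι dA dB,
    Filter.Tendsto (fun t => (P t).povm) Filter.atTop (nhds M)

/-- The measurement `M` identifies the states `ρ i` without error. -/
def Discriminates {ι : Type} [DecidableEq ι] {dA dB : ℕ} (M ρ : ι → BipOp dA dB) : Prop :=
  ∀ i j, (M j * ρ i).trace = if j = i then 1 else 0

/-- Density operators. -/
def IsState {dA dB : ℕ} (ρ : BipOp dA dB) : Prop := ρ.PosSemidef ∧ ρ.trace = 1

/-- Mutually orthogonal states whose sum has full rank. -/
structure IsFullOrthogonalSet {ι : Type} [Fintype ι] {dA dB : ℕ} (ρ : ι → BipOp dA dB) : Prop where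
  isState : ∀ i, IsState (ρ i)
  orthogonal : ∀ i j, i ≠ j → (ρ i * ρ j).trace = 0
  fullRank : (∑ i, ρ i).rank = dA * dB

end LOCC

/-!
A measurement that discriminates a full orthogonal set is forced: its `i`-th operator is the
orthogonal projection onto the range of `ρ i`, so it is a projective measurement `Q` all of whose
members except one are products.

Suppose that no `Q i` is `1`. In a protocol each branch contributes positive operators whose sum is
a product operator, and at a leaf all outcomes but one are excluded. As one follows the protocol
down the tree along convex combinations of a node and its children, a product family is met at the
moment where some outcome has a prescribed small relative weight: the family has zero margin. If
every product family of zero margin had positive error with respect to `Q`, then by compactness the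
error would be bounded below, uniformly over all protocols. Hence if `Q` is in asymptotic LOCC, some
product family of zero margin has no error. Its sum `A ⊗ B` commutes with every `Q i`, is not
scalar, and is not orthogonal to any nonzero `Q i`.

For a product `Q i` it follows that `A` and `B` commute with the factors of `Q i`. A party whose
factor is not scalar can therefore measure one of its spectral projections without disturbing `Q`,
and what remains is a measurement of the same kind in smaller dimension.
-/

namespace LOCC

theorem sum_sum_apply {ι κ α : Type*} [Fintype ι] [AddCommMonoid α] (s : Finset κ) (M : κ → ι → α) :
    ∑ i, (∑ k ∈ s, M k) i = ∑ k ∈ s, ∑ i, M k i := by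
  simp only [Finset.sum_apply]
  exact Finset.sum_comm

section Pullback

variable {𝕜 : Type*} [RCLike 𝕜] {ι l m n : Type*} [Fintype m]

/-- The measurement `M` performed after the operation with the single Kraus operator `W`. -/
def pullback (W : Matrix m n 𝕜) (M : ι → Matrix m m 𝕜) : ι → Matrix n n 𝕜 :=
  fun i => Wᴴ * M i * W

theorem pullback_pullback [Fintype l] (V : Matrix m n 𝕜) (W : Matrix l m 𝕜)
    (M : ι → Matrix l l 𝕜) : pullback V (pullback W M) = pullback (W * V) M := by
  ext1 i
  simp only [pullback, Matrix.conjTranspose_mul, Matrix.mul_assoc]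

theorem pullback_one [DecidableEq m] (M : ι → Matrix m m 𝕜) : pullback 1 M = M := by
  ext1 i
  simp [pullback]

theorem pullback_sum {κ : Type*} (s : Finset κ) (W : Matrix m n 𝕜) (M : κ → ι → Matrix m m 𝕜) :
    pullback W (∑ k ∈ s, M k) = ∑ k ∈ s, pullback W (M k) := by
  ext1 i
  simp only [pullback, Finset.sum_apply, Matrix.mul_sum, Matrix.sum_mul]

theorem sum_pullback [Fintype ι] (W : Matrix m n 𝕜) (M : ι → Matrix m m 𝕜) :
    ∑ i, pullback W M i = Wᴴ * (∑ i, M i) * W := by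
  simp only [pullback, Matrix.mul_sum, Matrix.sum_mul]

theorem posSemidef_pullback [Finite n] (W : Matrix m n 𝕜) {M : ι → Matrix m m 𝕜}
    (hM : ∀ i, (M i).PosSemidef) (i : ι) : (pullback W M i).PosSemidef :=
  (hM i).conjTranspose_mul_mul_same W

theorem continuous_pullback (W : Matrix m n 𝕜) :
    Continuous (pullback W : (ι → Matrix m m 𝕜) → ι → Matrix n n 𝕜) :=
  continuous_pi fun i => (continuous_const.matrix_mul (continuous_apply i)).matrix_mul
    continuous_const

end Pullback

theorem sum_kronecker {R κ l m n p : Type*} [CommSemiring R] (s : Finset κ)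
    (A : κ → Matrix l m R) (B : Matrix n p R) : (∑ k ∈ s, A k) ⊗ₖ B = ∑ k ∈ s, A k ⊗ₖ B :=
  map_sum ((Matrix.kroneckerBilinear (R := R)).flip B) A s

theorem kronecker_sum {R κ l m n p : Type*} [CommSemiring R] (A : Matrix l m R) (s : Finset κ)
    (B : κ → Matrix n p R) : A ⊗ₖ (∑ k ∈ s, B k) = ∑ k ∈ s, A ⊗ₖ B k :=
  map_sum (Matrix.kroneckerBilinear (R := R) A) B s

section LinearAlgebra

variable {𝕜 : Type*} [RCLike 𝕜] {m n : Type*} [Fintype m] [Fintype n]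

open scoped MatrixOrder in
theorem exists_eq_conjTranspose_mul_self {A : Matrix n n 𝕜} (hA : A.PosSemidef) :
    ∃ U : Matrix n n 𝕜, A = Uᴴ * U := by
  classical
  exact CStarAlgebra.nonneg_iff_eq_star_mul_self.mp hA.nonneg

theorem trace_mul_nonneg {A B : Matrix n n 𝕜} (hA : A.PosSemidef) (hB : B.PosSemidef) :
    0 ≤ (A * B).trace := by
  obtain ⟨V, rfl⟩ := exists_eq_conjTranspose_mul_self hB
  rw [← Matrix.mul_assoc, Matrix.trace_mul_comm, ← Matrix.mul_assoc]
  exact (hA.mul_mul_conjTranspose_same V).trace_nonneg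

theorem mul_eq_zero_of_trace_mul_eq_zero {A B : Matrix n n 𝕜} (hA : A.PosSemidef)
    (hB : B.PosSemidef) (h : (A * B).trace = 0) : A * B = 0 := by
  obtain ⟨U, rfl⟩ := exists_eq_conjTranspose_mul_self hA
  obtain ⟨V, rfl⟩ := exists_eq_conjTranspose_mul_self hB
  have htrace : ((U * Vᴴ)ᴴ * (U * Vᴴ)).trace = 0 := by
    rw [← h, ← Matrix.mul_assoc (Uᴴ * U), Matrix.trace_mul_comm _ V]
    simp [Matrix.mul_assoc]
  calc Uᴴ * U * (Vᴴ * V) = Uᴴ * (U * Vᴴ) * V := by simp only [Matrix.mul_assoc]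
    _ = 0 := by simp [Matrix.trace_conjTranspose_mul_self_eq_zero_iff.mp htrace]

/-- `e` is the orthogonal projection onto the range of `S`. -/
structure IsRangeProjection (e S : Matrix n n 𝕜) : Prop where
  isHermitian : e.IsHermitian
  mul_eq : e * S = S
  exists_eq_mul : ∃ X, e = S * X

theorem exists_isRangeProjection (S : Matrix n n 𝕜) : ∃ e, IsRangeProjection e S := by
  classical
  set T := S * Sᴴ with hT
  have hTself : IsSelfAdjoint T := Matrix.isHermitian_mul_conjTranspose_self S
  have hcont (f : ℝ → ℝ) : ContinuousOn f (spectrum ℝ T) := T.finite_real_spectrum.continuousOn f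
  let χ : ℝ → ℝ := fun x => if x = 0 then 0 else 1
  have hχT : cfc χ T * T = T := by
    nth_rw 2 [← cfc_id ℝ T]
    rw [← cfc_mul _ _ _ (hcont _) (hcont _)]
    conv_rhs => rw [← cfc_id ℝ T]
    congr! 2 with x
    by_cases hx : x = 0 <;> simp [χ, hx]
  have hTinv : cfc χ T = T * cfc (·⁻¹ : ℝ → ℝ) T := by
    conv_rhs => enter [1]; rw [← cfc_id ℝ T]
    rw [← cfc_mul _ _ _ (hcont _) (hcont _)]
    congr! 2 with x
    by_cases hx : x = 0 <;> simp [χ, hx]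
  refine ⟨cfc χ T, cfc_predicate χ T, ?_, Sᴴ * cfc (·⁻¹ : ℝ → ℝ) T, ?_⟩
  · rw [← sub_eq_zero, ← sub_one_mul, ← Matrix.mul_self_mul_conjTranspose_eq_zero, ← hT,
      sub_one_mul, hχT, sub_self]
  · rw [hTinv, hT, Matrix.mul_assoc]

namespace IsRangeProjection

variable {e f S : Matrix n n 𝕜}

theorem eq (he : IsRangeProjection e S) (hf : IsRangeProjection f S) : e = f := by
  obtain ⟨X, hX⟩ := he.exists_eq_mul
  obtain ⟨Y, hY⟩ := hf.exists_eq_mul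
  have hfe : f * e = e := by rw [hX, ← Matrix.mul_assoc, hf.mul_eq]
  have hef : e * f = f := by rw [hY, ← Matrix.mul_assoc, he.mul_eq]
  calc e = (f * e)ᴴ := by rw [hfe, he.isHermitian.eq]
    _ = f := by rw [Matrix.conjTranspose_mul, he.isHermitian.eq, hf.isHermitian.eq, hef]

theorem kronecker {f T : Matrix m m 𝕜} (he : IsRangeProjection e S) (hf : IsRangeProjection f T) :
    IsRangeProjection (e ⊗ₖ f) (S ⊗ₖ T) := by
  obtain ⟨X, hX⟩ := he.exists_eq_mul
  obtain ⟨Y, hY⟩ := hf.exists_eq_mul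
  refine ⟨?_, ?_, X ⊗ₖ Y, ?_⟩
  · rw [Matrix.IsHermitian, Matrix.conjTranspose_kronecker, he.isHermitian.eq, hf.isHermitian.eq]
  · rw [← Matrix.mul_kronecker_mul, he.mul_eq, hf.mul_eq]
  · rw [← Matrix.mul_kronecker_mul, ← hX, ← hY]

theorem exists_eq_kronecker {σ : Matrix m m 𝕜} {τ : Matrix n n 𝕜} {e : Matrix (m × n) (m × n) 𝕜}
    (he : IsRangeProjection e (σ ⊗ₖ τ)) : ∃ a b, e = a ⊗ₖ b := by
  obtain ⟨a, ha⟩ := exists_isRangeProjection σ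
  obtain ⟨b, hb⟩ := exists_isRangeProjection τ
  exact ⟨a, b, he.eq (ha.kronecker hb)⟩

end IsRangeProjection

/-- `p` consists of mutually orthogonal orthogonal projections that sum to the identity. -/
structure IsProjectiveMeasurement {ι : Type*} [Fintype ι] [DecidableEq n]
    (p : ι → Matrix n n 𝕜) : Prop extends CompleteOrthogonalIdempotents p where
  isHermitian : ∀ i, (p i).IsHermitian

theorem isProjectiveMeasurement_pair [DecidableEq n] {e : Matrix n n 𝕜} (he : IsStarProjection e) :
    IsProjectiveMeasurement ![e, 1 - e] where
  toCompleteOrthogonalIdempotents := .of_isIdempotentElem he.isIdempotentElem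
  isHermitian i := by
    fin_cases i
    · exact he.isSelfAdjoint
    · exact he.one_sub.isSelfAdjoint

theorem exists_isProjectiveMeasurement_of_not_scalar [DecidableEq n] {A : Matrix n n 𝕜}
    (hA : A.IsHermitian) (hscalar : ∀ c : 𝕜, A ≠ c • 1) :
    ∃ p : Fin 2 → Matrix n n 𝕜, IsProjectiveMeasurement p ∧ (∀ k, p k ≠ 1) ∧
      ∀ k a, Commute A a → Commute (p k) a := by
  have hcont (f : ℝ → ℝ) : ContinuousOn f (spectrum ℝ A) := A.finite_real_spectrum.continuousOn f
  have hself : IsSelfAdjoint A := hA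
  have : Nontrivial (Matrix n n 𝕜) := nontrivial_of_ne A _ (hscalar 0)
  obtain ⟨x, hx⟩ : (spectrum ℝ A).Nonempty :=
    ContinuousFunctionalCalculus.spectrum_nonempty A hself
  let χ : ℝ → ℝ := fun y => if y = x then 1 else 0
  have he : IsStarProjection (cfc χ A) := by
    refine ⟨?_, cfc_predicate χ A⟩
    rw [IsIdempotentElem, ← cfc_mul _ _ _ (hcont _) (hcont _)]
    congr! 2 with y
    simp [χ]
  have hAe : A * cfc χ A = x • cfc χ A := by
    conv_lhs => enter [1]; rw [← cfc_id ℝ A]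
    rw [← cfc_mul _ _ _ (hcont _) (hcont _), ← cfc_const_mul _ _ _ (hcont _)]
    congr! 2 with y
    by_cases hy : y = x <;> simp [χ, hy]
  have he_ne_zero : cfc χ A ≠ 0 := fun h => by
    have : (1 : ℝ) ∈ spectrum ℝ (cfc χ A) := by
      rw [cfc_map_spectrum χ A hself (hcont _)]
      exact ⟨x, hx, by simp [χ]⟩
    simp [h, spectrum.zero_eq] at this
  refine ⟨![cfc χ A, 1 - cfc χ A], isProjectiveMeasurement_pair he, fun k h => ?_, fun k a ha => ?_⟩
  · fin_cases k
    · replace h : cfc χ A = 1 := h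
      apply hscalar x
      rwa [h, mul_one, RCLike.real_smul_eq_coe_smul (K := 𝕜)] at hAe
    · exact he_ne_zero (sub_eq_self.mp h)
  · have hcomm : Commute (cfc χ A) a := ha.cfc_real χ
    fin_cases k
    · exact hcomm
    · exact (Commute.one_left a).sub_left hcomm

theorem exists_isometry_of_isStarProjection [DecidableEq n] {p : Matrix n n 𝕜}
    (hp : IsStarProjection p) (hone : p ≠ 1) :
    ∃ d < Fintype.card n, ∃ V : Matrix n (Fin d) 𝕜, Vᴴ * V = 1 ∧ V * Vᴴ = p := by
  have hpH : p.IsHermitian := hp.isSelfAdjoint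
  let U : Matrix n n 𝕜 := hpH.eigenvectorUnitary
  let l := hpH.eigenvalues
  have hUU : Uᴴ * U = 1 := Unitary.coe_star_mul_self hpH.eigenvectorUnitary
  have hUU' : U * Uᴴ = 1 := Unitary.coe_mul_star_self hpH.eigenvectorUnitary
  have hpU : p = U * Matrix.diagonal (RCLike.ofReal ∘ l) * Uᴴ := by
    conv_lhs => rw [hpH.spectral_theorem, Unitary.conjStarAlgAut_apply]
    rfl
  have hl x : l x = 0 ∨ l x = 1 :=
    hp.isIdempotentElem.spectrum_subset ℝ (hpH.eigenvalues_mem_spectrum_real x)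
  have hlt : Fintype.card {x // l x = 1} < Fintype.card n := by
    obtain ⟨x, hx⟩ : ∃ x, l x ≠ 1 := by
      by_contra! hall
      apply hone
      rw [hpU, funext hall]
      simp [Function.comp_def, hUU']
    exact Fintype.card_subtype_lt hx
  let f := (Fintype.equivFin {x // l x = 1}).symm
  let c : Fin (Fintype.card {x // l x = 1}) → n := fun y => f y
  have hc : Function.Injective c := Subtype.val_injective.comp f.injective
  refine ⟨_, hlt, U.submatrix id c, ?_, ?_⟩
  · rw [Matrix.conjTranspose_submatrix, ← Matrix.submatrix_mul _ _ _ _ _ Function.bijective_id, hUU,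
      Matrix.submatrix_one _ hc]
  · ext i j
    calc (U.submatrix id c * (U.submatrix id c)ᴴ) i j
        = ∑ x : {x // l x = 1}, U i x * star (U j x) :=
          f.sum_comp fun x : {x // l x = 1} => U i x * star (U j x)
      _ = ∑ x, if l x = 1 then U i x * star (U j x) else 0 := by
          rw [← Finset.sum_filter]
          exact (Finset.sum_subtype {x | l x = 1} (fun x => by simp)
            fun x => U i x * star (U j x)).symm
      _ = (U * Matrix.diagonal (RCLike.ofReal ∘ l) * Uᴴ : Matrix n n 𝕜) i j := by
          rw [Matrix.mul_apply]
          refine Finset.sum_congr rfl fun x _ => ?_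
          rcases hl x with h | h <;> simp [h, Matrix.mul_diagonal]
      _ = p i j := by rw [← hpU]

namespace IsProjectiveMeasurement

variable {ι : Type*} [Fintype ι] [DecidableEq n] {Q : ι → Matrix n n 𝕜}

theorem isStarProjection (hQ : IsProjectiveMeasurement Q) (i : ι) : IsStarProjection (Q i) :=
  ⟨hQ.idem i, hQ.isHermitian i⟩

theorem posSemidef (hQ : IsProjectiveMeasurement Q) (i : ι) : (Q i).PosSemidef := by
  have h := Matrix.posSemidef_conjTranspose_mul_self (Q i)
  rwa [(hQ.isHermitian i).eq, hQ.idem i] at h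

theorem one_sub_eq_sum [DecidableEq ι] (hQ : IsProjectiveMeasurement Q) (i : ι) :
    1 - Q i = ∑ j ∈ Finset.univ.erase i, Q j := by
  rw [sub_eq_iff_eq_add, ← hQ.complete, Finset.sum_erase_add _ _ (Finset.mem_univ i)]

theorem one_sub_posSemidef (hQ : IsProjectiveMeasurement Q) (i : ι) : (1 - Q i).PosSemidef := by
  classical
  rw [hQ.one_sub_eq_sum]
  exact Matrix.posSemidef_sum _ fun j _ => hQ.posSemidef j

theorem exists_ne_and_ne_zero (hQ : IsProjectiveMeasurement Q) {i : ι} (hi : Q i ≠ 1) :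
    ∃ j, j ≠ i ∧ Q j ≠ 0 := by
  classical
  by_contra! h
  have hsub := hQ.one_sub_eq_sum i
  rw [Finset.sum_eq_zero fun j hj => h j (Finset.ne_of_mem_erase hj), sub_eq_zero] at hsub
  exact hi hsub.symm

theorem trace_mul_le_trace_mul_one_sub (hQ : IsProjectiveMeasurement Q) {i j : ι} (hij : j ≠ i)
    {S : Matrix n n 𝕜} (hS : S.PosSemidef) :
    (S * Q j).trace ≤ (S * (1 - Q i)).trace := by
  classical
  rw [hQ.one_sub_eq_sum, Finset.mul_sum, Matrix.trace_sum]
  exact Finset.single_le_sum (f := fun j => (S * Q j).trace)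
    (fun k _ => trace_mul_nonneg hS (hQ.posSemidef k)) (by simpa using hij)

theorem commute_of_forall_ne (hQ : IsProjectiveMeasurement Q) {R : Matrix n n 𝕜} {i₀ : ι}
    (h : ∀ i, i ≠ i₀ → Commute R (Q i)) (i : ι) : Commute R (Q i) := by
  classical
  by_cases hi : i = i₀
  · have hsum : Q i = 1 - ∑ j ∈ Finset.univ.erase i, Q j := by
      rw [← hQ.one_sub_eq_sum, sub_sub_cancel]
    rw [hsum]
    exact (Commute.one_right R).sub_right
      (Commute.sum_right _ _ _ fun j hj => h j (hi ▸ Finset.ne_of_mem_erase hj))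
  · exact h i hi

theorem commute_sum (hQ : IsProjectiveMeasurement Q) {X : ι → Matrix n n 𝕜}
    (hX : ∀ i, (X i).PosSemidef) (h : ∀ i, (X i * (1 - Q i)).trace = 0) (j : ι) :
    Commute (∑ i, X i) (Q j) := by
  have hXQ i : X i * Q i = X i := by
    have := mul_eq_zero_of_trace_mul_eq_zero (hX i) (hQ.one_sub_posSemidef i) (h i)
    rwa [mul_one_sub, sub_eq_zero, eq_comm] at this
  have hQX i : Q i * X i = X i := by
    simpa [(hQ.isHermitian i).eq, (hX i).1.eq] using congrArg Matrix.conjTranspose (hXQ i)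
  refine Commute.sum_left _ _ _ fun i _ => ?_
  by_cases hij : i = j
  · rw [← hij, Commute, SemiconjBy, hXQ, hQX]
  · calc X i * Q j = X i * (Q i * Q j) := by rw [← mul_assoc, hXQ]
      _ = Q j * Q i * X i := by rw [hQ.ortho hij, hQ.ortho (Ne.symm hij), mul_zero, zero_mul]
      _ = Q j * X i := by rw [mul_assoc, hQX]

protected theorem pullback [DecidableEq m] (hQ : IsProjectiveMeasurement Q) {W : Matrix n m 𝕜}
    (hW : Wᴴ * W = 1) (hcomm : ∀ i, Commute (W * Wᴴ) (Q i)) :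
    IsProjectiveMeasurement (pullback W Q) := by
  have hmul i j : Wᴴ * Q i * W * (Wᴴ * Q j * W) = Wᴴ * (Q i * Q j) * W := by
    calc Wᴴ * Q i * W * (Wᴴ * Q j * W) = Wᴴ * (Q i * (W * Wᴴ)) * Q j * W := by
          simp only [Matrix.mul_assoc]
      _ = (Wᴴ * W) * Wᴴ * (Q i * Q j) * W := by
          rw [← (hcomm i).eq]; simp only [Matrix.mul_assoc]
      _ = _ := by rw [hW, Matrix.one_mul]
  refine ⟨⟨⟨fun i => ?_, fun i j hij => ?_⟩, ?_⟩, fun i => ?_⟩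
  · exact (hmul i i).trans (by rw [hQ.idem i]; rfl)
  · exact (hmul i j).trans (by rw [hQ.ortho hij, Matrix.mul_zero, Matrix.zero_mul])
  · rw [sum_pullback, hQ.complete, Matrix.mul_one, hW]
  · exact Matrix.isHermitian_conjTranspose_mul_mul W (hQ.isHermitian i)

theorem sum_pullback_eq {κ : Type*} (hQ : IsProjectiveMeasurement Q) {M : κ → Matrix n n 𝕜}
    (hcomm : ∀ i k, Commute (Q i) (M k)) : ∑ i, pullback (Q i) M = M := by
  ext1 k
  rw [Finset.sum_apply]
  calc ∑ i, (Q i)ᴴ * M k * Q i = ∑ i, Q i * M k := Finset.sum_congr rfl fun i _ => by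
        rw [(hQ.isHermitian i).eq, Matrix.mul_assoc, ← (hcomm i k).eq, ← Matrix.mul_assoc,
          hQ.idem i]
    _ = M k := by rw [← Finset.sum_mul, hQ.complete, one_mul]

theorem kronecker_one [DecidableEq m] (hQ : IsProjectiveMeasurement Q) :
    IsProjectiveMeasurement fun i => Q i ⊗ₖ (1 : Matrix m m 𝕜) := by
  refine ⟨⟨⟨fun i => ?_, fun i j hij => ?_⟩, ?_⟩, fun i => ?_⟩
  · rw [IsIdempotentElem, ← Matrix.mul_kronecker_mul, hQ.idem i, one_mul]
  · change Q i ⊗ₖ _ * Q j ⊗ₖ _ = 0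
    rw [← Matrix.mul_kronecker_mul, hQ.ortho hij, Matrix.zero_kronecker]
  · rw [← sum_kronecker, hQ.complete, Matrix.one_kronecker_one]
  · rw [Matrix.IsHermitian, Matrix.conjTranspose_kronecker, (hQ.isHermitian i).eq,
      Matrix.conjTranspose_one]

theorem submatrix_equiv [DecidableEq m] (hQ : IsProjectiveMeasurement Q) (e : m ≃ n) :
    IsProjectiveMeasurement fun i => (Q i).submatrix e e where
  toCompleteOrthogonalIdempotents :=
    hQ.toCompleteOrthogonalIdempotents.map (Matrix.reindexAlgEquiv ℕ 𝕜 e.symm).toRingHom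
  isHermitian i := (hQ.isHermitian i).submatrix e

end IsProjectiveMeasurement

end LinearAlgebra

section SwapParties

variable {ι : Type*} {dA dB : ℕ}

/-- The measurement `M` with the two tensor factors exchanged. -/
def swapParties (M : ι → BipOp dA dB) : ι → BipOp dB dA :=
  fun i => (M i).submatrix Prod.swap Prod.swap

theorem submatrix_swap_kronecker {R l m n p : Type*} [CommMagma R] (a : Matrix l m R)
    (b : Matrix n p R) : (a ⊗ₖ b).submatrix Prod.swap Prod.swap = b ⊗ₖ a := by
  ext i j
  exact mul_comm _ _

theorem swapParties_pullback {dA' dB' : ℕ} (a : Matrix (Fin dA') (Fin dA) ℂ)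
    (b : Matrix (Fin dB') (Fin dB) ℂ) (M : ι → BipOp dA' dB') :
    swapParties (pullback (a ⊗ₖ b) M) = pullback (b ⊗ₖ a) (swapParties M) := by
  ext1 i
  simp only [swapParties, pullback, ← submatrix_swap_kronecker a b, Matrix.conjTranspose_submatrix]
  rw [Matrix.submatrix_mul _ _ _ _ _ Prod.swap_bijective,
    Matrix.submatrix_mul _ _ _ _ _ Prod.swap_bijective]

theorem swapParties_sum {κ : Type*} (s : Finset κ) (M : κ → ι → BipOp dA dB) :
    swapParties (∑ k ∈ s, M k) = ∑ k ∈ s, swapParties (M k) := by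
  ext i
  simp only [swapParties, Finset.sum_apply, Matrix.submatrix_apply, Matrix.sum_apply]

theorem swapParties_swapParties (M : ι → BipOp dA dB) : swapParties (swapParties M) = M :=
  rfl

theorem continuous_swapParties :
    Continuous (swapParties : (ι → BipOp dA dB) → ι → BipOp dB dA) :=
  continuous_pi fun i => (continuous_apply i).matrix_submatrix _ _

theorem IsProjectiveMeasurement.swapParties [Fintype ι] {Q : ι → BipOp dA dB}
    (hQ : IsProjectiveMeasurement Q) : IsProjectiveMeasurement (swapParties Q) :=
  hQ.submatrix_equiv (Equiv.prodComm _ _)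

end SwapParties

section Protocol

variable {ι : Type} [DecidableEq ι] {dA dB : ℕ}

namespace Protocol

theorem povm_alice (I : Instrument dA) (next : ∀ k, Protocol ι (I.outDim k) dB) :
    (alice I next).povm =
      ∑ k, ∑ j, pullback (I.kraus k j ⊗ₖ (1 : Matrix (Fin dB) (Fin dB) ℂ)) (next k).povm := by
  ext1 i
  simp only [Finset.sum_apply]
  rfl

theorem povm_bob (I : Instrument dB) (next : ∀ k, Protocol ι dA (I.outDim k)) :
    (bob I next).povm =
      ∑ k, ∑ j, pullback ((1 : Matrix (Fin dA) (Fin dA) ℂ) ⊗ₖ I.kraus k j) (next k).povm := by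
  ext1 i
  simp only [Finset.sum_apply]
  rfl

/-- The protocol with the roles of the two parties exchanged. -/
def swap : {dA dB : ℕ} → Protocol ι dA dB → Protocol ι dB dA
  | _, _, .declare i => .declare i
  | _, _, .alice I next => .bob I fun k => (next k).swap
  | _, _, .bob I next => .alice I fun k => (next k).swap

end Protocol

theorem Protocol.povm_swap (P : Protocol ι dA dB) : P.swap.povm = swapParties P.povm := by
  induction P with
  | declare i₀ =>
    ext1 i
    by_cases h : i = i₀
    · simp [swap, povm, swapParties, h, Matrix.submatrix_one _ Prod.swap_injective]
    · simp [swap, povm, swapParties, h]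
  | alice I next ih =>
    simp only [swap, povm_alice, povm_bob, ih, swapParties_sum, swapParties_pullback]
  | bob I next ih =>
    simp only [swap, povm_alice, povm_bob, ih, swapParties_sum, swapParties_pullback]

theorem IsFiniteLOCC.swapParties {M : ι → BipOp dA dB} (hM : IsFiniteLOCC M) :
    IsFiniteLOCC (swapParties M) := by
  obtain ⟨P, rfl⟩ := hM
  exact ⟨P.swap, P.povm_swap⟩

theorem IsAsymptoticLOCC.swapParties {M : ι → BipOp dA dB} (hM : IsAsymptoticLOCC M) :
    IsAsymptoticLOCC (swapParties M) := by
  obtain ⟨P, hP⟩ := hM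
  refine ⟨fun t => (P t).swap, ?_⟩
  simp only [Protocol.povm_swap]
  exact (continuous_swapParties.tendsto M).comp hP

namespace Protocol

theorem sum_povm [Fintype ι] (P : Protocol ι dA dB) : ∑ i, P.povm i = 1 := by
  induction P with
  | declare i₀ => simp [povm]
  | alice I next ih =>
    simp only [povm_alice, sum_sum_apply, sum_pullback, ih, Matrix.mul_one,
      Matrix.conjTranspose_kronecker, Matrix.conjTranspose_one, ← Matrix.mul_kronecker_mul,
      ← sum_kronecker, I.complete, Matrix.one_kronecker_one]
  | bob I next ih =>
    simp only [povm_bob, sum_sum_apply, sum_pullback, ih, Matrix.mul_one,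
      Matrix.conjTranspose_kronecker, Matrix.conjTranspose_one, ← Matrix.mul_kronecker_mul,
      ← kronecker_sum, I.complete, Matrix.one_kronecker_one]

theorem posSemidef_povm (P : Protocol ι dA dB) : ∀ i, (P.povm i).PosSemidef := by
  induction P with
  | declare i₀ =>
    intro i
    simp only [povm]
    split
    · exact .one
    · exact .zero
  | alice I next ih =>
    intro i
    simp only [povm_alice, Finset.sum_apply]
    exact Matrix.posSemidef_sum _ fun k _ => Matrix.posSemidef_sum _ fun j _ =>
      posSemidef_pullback _ (ih k) i
  | bob I next ih =>
    intro i
    simp only [povm_bob, Finset.sum_apply]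
    exact Matrix.posSemidef_sum _ fun k _ => Matrix.posSemidef_sum _ fun j _ =>
      posSemidef_pullback _ (ih k) i

variable {m n : Type*}

theorem pullback_kronecker_povm_alice (I : Instrument dA)
    (next : ∀ k, Protocol ι (I.outDim k) dB) (K : Matrix (Fin dA) m ℂ)
    (L : Matrix (Fin dB) n ℂ) :
    pullback (K ⊗ₖ L) (alice I next).povm =
      ∑ x : Σ k, Fin (I.numKraus k), pullback ((I.kraus x.1 x.2 * K) ⊗ₖ L) (next x.1).povm := by
  simp only [povm_alice, pullback_sum, pullback_pullback, ← Matrix.mul_kronecker_mul,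
    Matrix.one_mul, Fintype.sum_sigma]

theorem pullback_kronecker_povm_bob (I : Instrument dB)
    (next : ∀ k, Protocol ι dA (I.outDim k)) (K : Matrix (Fin dA) m ℂ)
    (L : Matrix (Fin dB) n ℂ) :
    pullback (K ⊗ₖ L) (bob I next).povm =
      ∑ x : Σ k, Fin (I.numKraus k), pullback (K ⊗ₖ (I.kraus x.1 x.2 * L)) (next x.1).povm := by
  simp only [povm_bob, pullback_sum, pullback_pullback, ← Matrix.mul_kronecker_mul,
    Matrix.one_mul, Fintype.sum_sigma]

theorem sum_pullback_kronecker_povm [Fintype ι] (P : Protocol ι dA dB)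
    (K : Matrix (Fin dA) m ℂ) (L : Matrix (Fin dB) n ℂ) :
    ∑ i, pullback (K ⊗ₖ L) P.povm i = (Kᴴ * K) ⊗ₖ (Lᴴ * L) := by
  rw [sum_pullback, P.sum_povm, Matrix.mul_one, Matrix.conjTranspose_kronecker,
    ← Matrix.mul_kronecker_mul]

end Protocol

/-- The instrument with one Kraus operator for each outcome. -/
def Instrument.ofKraus {d N : ℕ} {e : Fin N → ℕ} (K : ∀ k, Matrix (Fin (e k)) (Fin d) ℂ)
    (hK : ∑ k, (K k)ᴴ * K k = 1) : Instrument d where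
  numOutcomes := N
  outDim := e
  numKraus _ := 1
  kraus k _ := K k
  complete := by simpa using hK

theorem IsFiniteLOCC.sum_pullback {N : ℕ} {e : Fin N → ℕ} {K : ∀ k, Matrix (Fin (e k)) (Fin dA) ℂ}
    (hK : ∑ k, (K k)ᴴ * K k = 1) {M : ∀ k, ι → BipOp (e k) dB} (hM : ∀ k, IsFiniteLOCC (M k)) :
    IsFiniteLOCC (∑ k, pullback (K k ⊗ₖ (1 : Matrix (Fin dB) (Fin dB) ℂ)) (M k)) := by
  choose P hP using hM
  refine ⟨.alice (.ofKraus K hK) P,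
    (Protocol.povm_alice _ _).trans <| Finset.sum_congr rfl fun k _ => ?_⟩
  exact (Fin.sum_univ_one _).trans (congrArg _ (hP k))

theorem IsAsymptoticLOCC.pullback {d : ℕ} {V : Matrix (Fin dA) (Fin d) ℂ} (hV : Vᴴ * V = 1)
    {M : ι → BipOp dA dB} (hM : IsAsymptoticLOCC M) :
    IsAsymptoticLOCC (pullback (V ⊗ₖ (1 : Matrix (Fin dB) (Fin dB) ℂ)) M) := by
  obtain ⟨P, hP⟩ := hM
  have hpovm t : IsFiniteLOCC
      (LOCC.pullback (V ⊗ₖ (1 : Matrix (Fin dB) (Fin dB) ℂ)) (P t).povm) := by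
    simpa using IsFiniteLOCC.sum_pullback (K := fun _ : Fin 1 => V) (by simpa using hV)
      fun _ => ⟨P t, rfl⟩
  choose P' hP' using hpovm
  refine ⟨P', ?_⟩
  simp only [hP']
  exact ((continuous_pullback _).tendsto M).comp hP

end Protocol

theorem map_sum_nonneg_of_segment_subset {E κ : Type*} [AddCommGroup E] [Module ℝ E]
    [TopologicalSpace E] [IsTopologicalAddGroup E] [ContinuousSMul ℝ E] [Fintype κ]
    (f : E →ₗ[ℝ] ℝ) {g : E → ℝ} (hg : Continuous g) {G : Set E}
    (hG : ∀ z ∈ G, g z = 0 → 0 ≤ f z) {y : κ → E}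
    (hpos : 0 < g (∑ k, y k)) (hseg : ∀ k, segment ℝ (∑ k, y k) (y k) ⊆ G)
    (hy : ∀ k, 0 < g (y k) → 0 ≤ f (y k)) : 0 ≤ f (∑ k, y k) := by
  by_contra! hneg
  obtain ⟨k, hk⟩ : ∃ k, f (y k) < 0 := by
    by_contra! h
    rw [map_sum] at hneg
    exact hneg.not_ge (Finset.sum_nonneg fun k _ => h k)
  have hgk : g (y k) ≤ 0 := not_lt.mp fun h => (hy k h).not_gt hk
  obtain ⟨z, hz, hgz⟩ : (0 : ℝ) ∈ g '' segment ℝ (∑ k, y k) (y k) :=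
    (convex_segment _ _).isPreconnected.intermediate_value (right_mem_segment ..)
      (left_mem_segment ..) hg.continuousOn ⟨hgk, hpos.le⟩
  have hfz : f z < 0 := (convex_halfSpace_lt f.isLinear 0).segment_subset hneg hk hz
  exact (hG z (hseg k hz) hgz).not_gt hfz

section Pairing

variable {ι n : Type*} [Fintype ι] [Fintype n]

/-- The total overlap of two families of operators. For an unnormalized measurement `X`,
`pairing 1 X` is its total weight, `pairing (1 - Q) X` the weight on which `X` disagrees with the
measurement `Q`, and `pairing (fun _ => R) X` the weight of `∑ i, X i` on `R`. -/
noncomputable def pairing (R : ι → Matrix n n ℂ) : (ι → Matrix n n ℂ) →ₗ[ℝ] ℝ where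
  toFun X := ∑ i, (X i * R i).trace.re
  map_add' X Y := by
    simp only [Pi.add_apply, add_mul, Matrix.trace_add, Complex.add_re, Finset.sum_add_distrib]
  map_smul' r X := by
    simp only [Pi.smul_apply, smul_mul_assoc, Matrix.trace_smul, Complex.real_smul,
      Complex.re_ofReal_mul, Finset.mul_sum, smul_eq_mul, RingHom.id_apply]

theorem pairing_apply (R X : ι → Matrix n n ℂ) : pairing R X = ∑ i, (X i * R i).trace.re :=
  rfl

theorem pairing_const (R : Matrix n n ℂ) (X : ι → Matrix n n ℂ) :
    pairing (fun _ => R) X = ((∑ i, X i) * R).trace.re := by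
  rw [pairing_apply, Finset.sum_mul, Matrix.trace_sum, Complex.re_sum]

theorem pairing_one [DecidableEq n] (X : ι → Matrix n n ℂ) :
    pairing 1 X = (∑ i, X i).trace.re := by
  rw [← mul_one (∑ i, X i)]
  exact pairing_const 1 X

theorem pairing_one_pos_of_sum_eq_one [DecidableEq n] [Nonempty n] {X : ι → Matrix n n ℂ}
    (hX : ∑ i, X i = 1) : 0 < pairing 1 X := by
  rw [pairing_one, hX, Matrix.trace_one, Complex.natCast_re]
  exact_mod_cast Fintype.card_pos

theorem continuous_pairing (R : ι → Matrix n n ℂ) : Continuous (pairing R) :=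
  (pairing R).continuous_of_finiteDimensional

theorem pairing_nonneg {R X : ι → Matrix n n ℂ} (hR : ∀ i, (R i).PosSemidef)
    (hX : ∀ i, (X i).PosSemidef) : 0 ≤ pairing R X :=
  Finset.sum_nonneg fun i _ => (Complex.le_def.mp (trace_mul_nonneg (hX i) (hR i))).1

theorem trace_mul_eq_zero_of_pairing_eq_zero {R X : ι → Matrix n n ℂ}
    (hR : ∀ i, (R i).PosSemidef) (hX : ∀ i, (X i).PosSemidef) (h : pairing R X = 0) (i : ι) :
    (X i * R i).trace = 0 := by
  have hnonneg j : 0 ≤ (X j * R j).trace := trace_mul_nonneg (hX j) (hR j)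
  have hre : (X i * R i).trace.re = 0 := (Finset.sum_eq_zero_iff_of_nonneg fun j _ =>
    (Complex.le_def.mp (hnonneg j)).1).mp h i (Finset.mem_univ i)
  exact Complex.ext hre (Complex.le_def.mp (hnonneg i)).2.symm

end Pairing

section Margin

variable {ι n : Type*} [Fintype ι] [Fintype n] [DecidableEq n] {Q : ι → Matrix n n ℂ} {c : ℝ}
  {X : ι → Matrix n n ℂ}

/-- A positive margin means that, among the outcomes that can occur at all, `X` excludes none: its
relative weight on each of them exceeds `c`. -/
noncomputable def margin (Q : ι → Matrix n n ℂ) (c : ℝ) (X : ι → Matrix n n ℂ) : ℝ :=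
  ⨅ j : {j // Q j ≠ 0}, pairing (fun _ => Q j) X - c * pairing 1 X

theorem margin_le {j : ι} (hj : Q j ≠ 0) :
    margin Q c X ≤ pairing (fun _ => Q j) X - c * pairing 1 X :=
  ciInf_le (Set.finite_range _).bddBelow (⟨j, hj⟩ : {j // Q j ≠ 0})

theorem margin_smul {r : ℝ} (hr : 0 ≤ r) : margin Q c (r • X) = r * margin Q c X := by
  rw [margin, margin, Real.mul_iInf_of_nonneg hr]
  congr! 2 with j
  simp only [map_smul, smul_eq_mul]
  ring

theorem continuous_margin (Q : ι → Matrix n n ℂ) (c : ℝ) : Continuous (margin Q c) := by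
  classical
  unfold margin
  cases isEmpty_or_nonempty {j // Q j ≠ 0}
  · simpa only [Real.iInf_of_isEmpty] using continuous_const
  · simp only [← Finset.inf'_univ_eq_ciInf]
    exact Continuous.finset_inf'_apply _ fun j _ =>
      (continuous_pairing _).sub (continuous_const.mul (continuous_pairing _))

theorem margin_pos_of_sum_eq_smul_one (hQ : ∀ j, (Q j).PosSemidef) (hne : ∃ j, Q j ≠ 0)
    (hc : ∀ j, Q j ≠ 0 → c * Fintype.card n < (Q j).trace.re) {s : ℂ} (hX : ∑ i, X i = s • 1)
    (hpos : 0 < pairing 1 X) : 0 < margin Q c X := by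
  obtain ⟨j₀, hj₀⟩ := hne
  have : Nonempty {j // Q j ≠ 0} := ⟨⟨j₀, hj₀⟩⟩
  have hone : pairing 1 X = s.re * Fintype.card n := by
    simp [pairing_one, hX]
  have hs : 0 < s.re := pos_of_mul_pos_left (hone ▸ hpos) (Nat.cast_nonneg _)
  obtain ⟨⟨j, hj⟩, hmin⟩ := exists_eq_ciInf_of_finite
    (f := fun j : {j // Q j ≠ 0} => pairing (fun _ => Q j) X - c * pairing 1 X)
  have hQj : pairing (fun _ => Q j) X = s.re * (Q j).trace.re := by
    have him : (Q j).trace.im = 0 := (Complex.le_def.mp (hQ j).trace_nonneg).2.symm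
    simp [pairing_const, hX, him]
  rw [margin, ← hmin, hQj, hone]
  nlinarith [mul_lt_mul_of_pos_left (hc j hj) hs]

end Margin

section Compactness

variable {m n : Type*} [Fintype m] [Fintype n]

theorem sq_norm_le_trace_conjTranspose_mul_self (U : Matrix m n ℂ) (i : m) (j : n) :
    ‖U i j‖ ^ 2 ≤ (Uᴴ * U).trace.re := by
  have htrace : (Uᴴ * U).trace.re = ∑ j, ∑ i, ‖U i j‖ ^ 2 := by
    simp only [Matrix.trace, Matrix.diag, Matrix.mul_apply, Matrix.conjTranspose_apply,
      Complex.re_sum, Complex.star_def, Complex.conj_mul', ← Complex.ofReal_pow, Complex.ofReal_re]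
  calc ‖U i j‖ ^ 2 ≤ ∑ i, ‖U i j‖ ^ 2 :=
        Finset.single_le_sum (f := fun i => ‖U i j‖ ^ 2) (fun _ _ => by positivity)
          (Finset.mem_univ i)
    _ ≤ (Uᴴ * U).trace.re := by
        rw [htrace]
        exact Finset.single_le_sum (f := fun j => ∑ i, ‖U i j‖ ^ 2)
          (fun _ _ => by positivity) (Finset.mem_univ j)

theorem isCompact_posSemidef_trace_le_one :
    IsCompact {A : Matrix n n ℂ | A.PosSemidef ∧ A.trace.re ≤ 1} := by
  have hcont : Continuous fun U : Matrix n n ℂ => Uᴴ * U :=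
    continuous_id.matrix_conjTranspose.matrix_mul continuous_id
  have hball : IsCompact {U : Matrix n n ℂ | ∀ i j, U i j ∈ Metric.closedBall 0 1} := by
    have hpi := isCompact_univ_pi fun _ : n => isCompact_univ_pi fun _ : n =>
      isCompact_closedBall (0 : ℂ) 1
    simp only [Set.pi, Set.mem_univ, true_implies, Set.mem_ofPred_eq] at hpi
    exact hpi
  have hcompact : IsCompact {U : Matrix n n ℂ | (Uᴴ * U).trace.re ≤ 1} := by
    refine hball.of_isClosed_subset
      (isClosed_le (Complex.continuous_re.comp hcont.matrix_trace) continuous_const)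
      fun U hU i j => ?_
    rw [mem_closedBall_zero_iff, ← sq_le_one_iff₀ (norm_nonneg _)]
    exact (sq_norm_le_trace_conjTranspose_mul_self U i j).trans hU
  convert hcompact.image hcont using 1
  ext A
  constructor
  · rintro ⟨hA, htrace⟩
    obtain ⟨U, rfl⟩ := exists_eq_conjTranspose_mul_self hA
    exact ⟨U, htrace, rfl⟩
  · rintro ⟨U, hU, rfl⟩
    exact ⟨Matrix.posSemidef_conjTranspose_mul_self U, hU⟩

end Compactness

section ProductFamilies

variable {ι : Type*} [Fintype ι] {dA dB : ℕ}

/-- The families of positive semidefinite operators whose sum is a positive semidefinite product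
operator. Each branch of an LOCC protocol contributes such a family to the measurement. -/
def productFamilies (ι : Type*) [Fintype ι] (dA dB : ℕ) : Set (ι → BipOp dA dB) :=
  {X | (∀ i, (X i).PosSemidef) ∧
    ∃ A B, A.PosSemidef ∧ B.PosSemidef ∧ ∑ i, X i = A ⊗ₖ B}

theorem posSemidef_of_mem_segment {κ : Type*} {n : Type*} [Finite n] {X Y Z : κ → Matrix n n ℂ}
    (hX : ∀ i, (X i).PosSemidef) (hY : ∀ i, (Y i).PosSemidef) (hZ : Z ∈ segment ℝ X Y) (i : κ) :
    (Z i).PosSemidef := by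
  obtain ⟨a, b, ha, hb, -, rfl⟩ := hZ
  exact ((hX i).smul ha).add ((hY i).smul hb)

theorem smul_mem_productFamilies {r : ℝ} (hr : 0 ≤ r) {X : ι → BipOp dA dB}
    (hX : X ∈ productFamilies ι dA dB) : r • X ∈ productFamilies ι dA dB := by
  obtain ⟨hpos, A, B, hA, hB, hsum⟩ := hX
  refine ⟨fun i => (hpos i).smul hr, r • A, B, hA.smul hr, hB, ?_⟩
  simp only [Pi.smul_apply, ← Finset.smul_sum, hsum, Matrix.smul_kronecker]

theorem segment_subset_productFamilies_of_eq_right {X Y : ι → BipOp dA dB}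
    (hX : ∀ i, (X i).PosSemidef) (hY : ∀ i, (Y i).PosSemidef)
    {A A' : Matrix (Fin dA) (Fin dA) ℂ} {B : Matrix (Fin dB) (Fin dB) ℂ}
    (hA : A.PosSemidef) (hA' : A'.PosSemidef) (hB : B.PosSemidef)
    (hXsum : ∑ i, X i = A ⊗ₖ B) (hYsum : ∑ i, Y i = A' ⊗ₖ B) :
    segment ℝ X Y ⊆ productFamilies ι dA dB := by
  intro Z hZ
  refine ⟨posSemidef_of_mem_segment hX hY hZ, ?_⟩
  obtain ⟨a, b, ha, hb, -, rfl⟩ := hZ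
  refine ⟨a • A + b • A', B, (hA.smul ha).add (hA'.smul hb), hB, ?_⟩
  simp only [Pi.add_apply, Pi.smul_apply, Finset.sum_add_distrib, ← Finset.smul_sum, hXsum, hYsum,
    Matrix.add_kronecker, Matrix.smul_kronecker]

theorem segment_subset_productFamilies_of_eq_left {X Y : ι → BipOp dA dB}
    (hX : ∀ i, (X i).PosSemidef) (hY : ∀ i, (Y i).PosSemidef)
    {A : Matrix (Fin dA) (Fin dA) ℂ} {B B' : Matrix (Fin dB) (Fin dB) ℂ}
    (hA : A.PosSemidef) (hB : B.PosSemidef) (hB' : B'.PosSemidef)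
    (hXsum : ∑ i, X i = A ⊗ₖ B) (hYsum : ∑ i, Y i = A ⊗ₖ B') :
    segment ℝ X Y ⊆ productFamilies ι dA dB := by
  intro Z hZ
  refine ⟨posSemidef_of_mem_segment hX hY hZ, ?_⟩
  obtain ⟨a, b, ha, hb, -, rfl⟩ := hZ
  refine ⟨A, a • B + b • B', hA, (hB.smul ha).add (hB'.smul hb), ?_⟩
  simp only [Pi.add_apply, Pi.smul_apply, Finset.sum_add_distrib, ← Finset.smul_sum, hXsum, hYsum,
    Matrix.kronecker_add, Matrix.kronecker_smul]

theorem exists_normalized_factors {X : ι → BipOp dA dB} (hX : X ∈ productFamilies ι dA dB)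
    (hone : pairing 1 X = 1) : ∃ A B, A.PosSemidef ∧ B.PosSemidef ∧ A.trace.re ≤ 1 ∧
      B.trace.re ≤ 1 ∧ ∑ i, X i = A ⊗ₖ B := by
  obtain ⟨-, A, B, hA, hB, hsum⟩ := hX
  have htrace : A.trace * B.trace = 1 := by
    have hnonneg := mul_nonneg hA.trace_nonneg hB.trace_nonneg
    rw [pairing_one, hsum, Matrix.trace_kronecker] at hone
    exact Complex.ext hone (Complex.le_def.mp hnonneg).2.symm
  refine ⟨B.trace • A, A.trace • B, hA.smul hB.trace_nonneg, hB.smul hA.trace_nonneg, ?_, ?_, ?_⟩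
  · rw [Matrix.trace_smul, smul_eq_mul, mul_comm, htrace, Complex.one_re]
  · rw [Matrix.trace_smul, smul_eq_mul, htrace, Complex.one_re]
  · rw [hsum, Matrix.smul_kronecker, Matrix.kronecker_smul, smul_smul, mul_comm, htrace, one_smul]

theorem isCompact_normalized_productFamilies :
    IsCompact {X ∈ productFamilies ι dA dB | pairing 1 X = 1} := by
  let K : Set (Matrix (Fin dA) (Fin dA) ℂ × Matrix (Fin dB) (Fin dB) ℂ × (ι → BipOp dA dB)) :=
    {A | A.PosSemidef ∧ A.trace.re ≤ 1} ×ˢ {B | B.PosSemidef ∧ B.trace.re ≤ 1} ×ˢ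
      Set.univ.pi fun _ => {X | X.PosSemidef ∧ X.trace.re ≤ 1}
  have hK : IsCompact K := isCompact_posSemidef_trace_le_one.prod
    (isCompact_posSemidef_trace_le_one.prod
      (isCompact_univ_pi fun _ => isCompact_posSemidef_trace_le_one))
  have hclosed : IsClosed {p : Matrix (Fin dA) (Fin dA) ℂ × Matrix (Fin dB) (Fin dB) ℂ ×
      (ι → BipOp dA dB) | ∑ i, p.2.2 i = p.1 ⊗ₖ p.2.1 ∧ pairing 1 p.2.2 = 1} := by
    refine (isClosed_eq (by fun_prop) (continuous_matrix fun i j => ?_)).inter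
      (isClosed_eq ((continuous_pairing 1).comp (by fun_prop)) continuous_const)
    exact (continuous_fst.matrix_elem i.1 j.1).mul
      ((continuous_fst.comp continuous_snd).matrix_elem i.2 j.2)
  convert (hK.inter_right hclosed).image (continuous_snd.comp continuous_snd) using 1
  ext X
  constructor
  · rintro ⟨hX, hone⟩
    obtain ⟨A, B, hA, hB, hAtr, hBtr, hsum⟩ := exists_normalized_factors hX hone
    refine ⟨(A, B, X), ⟨⟨⟨hA, hAtr⟩, ⟨hB, hBtr⟩, fun i _ => ⟨hX.1 i, ?_⟩⟩, hsum, hone⟩, rfl⟩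
    rw [pairing_one, Matrix.trace_sum, Complex.re_sum] at hone
    rw [← hone]
    exact Finset.single_le_sum (f := fun i => (X i).trace.re)
      (fun i _ => (Complex.le_def.mp (hX.1 i).trace_nonneg).1) (Finset.mem_univ i)
  · rintro ⟨⟨A, B, X⟩, ⟨⟨hA, hB, hX⟩, hsum, hone⟩, rfl⟩
    exact ⟨⟨fun i => (hX i trivial).1, A, B, hA.1, hB.1, hsum⟩, hone⟩

end ProductFamilies

section Error

open scoped Topology

theorem exists_pos_mul_lt_re_trace {κ n : Type*} [Finite κ] [Fintype n] {Q : κ → Matrix n n ℂ}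
    (hQ : ∀ j, (Q j).PosSemidef) (r : ℝ) : ∃ c > 0, ∀ j, Q j ≠ 0 → c * r < (Q j).trace.re := by
  have hsmall : ∀ᶠ c : ℝ in 𝓝[>] 0, ∀ j, Q j ≠ 0 → c * r < (Q j).trace.re := by
    refine Filter.eventually_all.mpr fun j => Filter.eventually_imp_distrib_left.mpr fun hj => ?_
    have htrace : 0 < (Q j).trace.re := (Complex.lt_def.mp <|
      (hQ j).trace_nonneg.lt_of_ne' ((hQ j).trace_eq_zero_iff.not.mpr hj)).1
    have hlim : Filter.Tendsto (fun c : ℝ => c * r) (𝓝[>] 0) (𝓝 (0 * r)) :=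
      ((continuous_mul_const r).tendsto 0).mono_left nhdsWithin_le_nhds
    exact hlim.eventually_lt_const (by rwa [zero_mul])
  obtain ⟨c, hcQ, hc⟩ := (hsmall.and self_mem_nhdsWithin).exists
  exact ⟨c, hc, hcQ⟩

variable {ι : Type} [Fintype ι] {dA dB : ℕ} {Q : ι → BipOp dA dB} {c : ℝ}

theorem IsProjectiveMeasurement.exists_pos_mul_pairing_one_le (hQ : IsProjectiveMeasurement Q)
    (hpos : ∀ X ∈ productFamilies ι dA dB, margin Q c X = 0 → pairing 1 X = 1 →
      0 < pairing (1 - Q) X) :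
    ∃ δ > 0, ∀ X ∈ productFamilies ι dA dB, margin Q c X = 0 →
      δ * pairing 1 X ≤ pairing (1 - Q) X := by
  have hcompact : IsCompact ({X ∈ productFamilies ι dA dB | pairing 1 X = 1} ∩
      {X | margin Q c X = 0}) := isCompact_normalized_productFamilies.inter_right
    (isClosed_eq (continuous_margin Q c) continuous_const)
  obtain ⟨δ, hδ, hle⟩ := hcompact.exists_forall_le' (continuous_pairing (1 - Q)).continuousOn
    (fun X hX => hpos X hX.1.1 hX.2 hX.1.2)
  refine ⟨δ, hδ, fun X hX hmargin => ?_⟩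
  rcases (pairing_nonneg (R := 1) (fun _ => .one) hX.1).eq_or_lt' with hzero | hweight
  · rw [hzero, mul_zero]
    exact pairing_nonneg hQ.one_sub_posSemidef hX.1
  · set w := pairing 1 X
    have hinv : 0 ≤ w⁻¹ := (inv_pos.mpr hweight).le
    have hnorm := hle (w⁻¹ • X) ⟨⟨smul_mem_productFamilies hinv hX,
      by rw [map_smul, smul_eq_mul, inv_mul_cancel₀ hweight.ne']⟩,
      by rw [Set.mem_ofPred_eq, margin_smul hinv, hmargin, mul_zero]⟩
    rwa [map_smul, smul_eq_mul, inv_mul_eq_div, le_div_iff₀ hweight] at hnorm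

variable [DecidableEq ι]

theorem IsProjectiveMeasurement.mul_pairing_one_le_of_declare (hQ : IsProjectiveMeasurement Q)
    (hne : ∀ i, Q i ≠ 1) {a b : ℕ} (W : Matrix (Fin a × Fin b) (Fin dA × Fin dB) ℂ) (i : ι)
    (h : 0 < margin Q c (pullback W (Protocol.declare i).povm)) :
    c * pairing 1 (pullback W (Protocol.declare i).povm) ≤
      pairing (1 - Q) (pullback W (Protocol.declare i).povm) := by
  set X := pullback W (Protocol.declare i).povm with hXdef
  have hX j : X j = if j = i then Wᴴ * W else 0 := by
    simp only [hXdef, pullback, Protocol.povm]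
    split <;> simp
  have hsum : ∑ j, X j = Wᴴ * W := by simp [hX]
  obtain ⟨j, hji, hj⟩ := hQ.exists_ne_and_ne_zero (hne i)
  calc c * pairing 1 X ≤ pairing (fun _ => Q j) X := by linarith [h.trans_le (margin_le hj)]
    _ = (Wᴴ * W * Q j).trace.re := by rw [pairing_const, hsum]
    _ ≤ (Wᴴ * W * (1 - Q i)).trace.re := (Complex.le_def.mp <|
        hQ.trace_mul_le_trace_mul_one_sub hji (Matrix.posSemidef_conjTranspose_mul_self W)).1
    _ = pairing (1 - Q) X := by
        rw [pairing_apply, Finset.sum_eq_single i (fun j _ hj => by simp [hX, hj]) (by simp), hX,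
          if_pos rfl]
        rfl

theorem IsProjectiveMeasurement.mul_pairing_one_le (hQ : IsProjectiveMeasurement Q)
    (hne : ∀ i, Q i ≠ 1) {δ : ℝ} (hδ : δ ≤ c)
    (hbound : ∀ X ∈ productFamilies ι dA dB, margin Q c X = 0 →
      δ * pairing 1 X ≤ pairing (1 - Q) X)
    {a b : ℕ} (P : Protocol ι a b) (K : Matrix (Fin a) (Fin dA) ℂ)
    (L : Matrix (Fin b) (Fin dB) ℂ) (h : 0 < margin Q c (pullback (K ⊗ₖ L) P.povm)) :
    δ * pairing 1 (pullback (K ⊗ₖ L) P.povm) ≤ pairing (1 - Q) (pullback (K ⊗ₖ L) P.povm) := by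
  let f : (ι → BipOp dA dB) →ₗ[ℝ] ℝ := pairing (1 - Q) - δ • pairing 1
  have hf X : 0 ≤ f X ↔ δ * pairing 1 X ≤ pairing (1 - Q) X := sub_nonneg
  have hpos {a b : ℕ} (P : Protocol ι a b) (W : Matrix (Fin a × Fin b) (Fin dA × Fin dB) ℂ) i :
      (pullback W P.povm i).PosSemidef := posSemidef_pullback W P.posSemidef_povm i
  simp only [← hf] at hbound ⊢
  induction P with
  | declare i =>
    have hone := pairing_nonneg (R := 1) (fun _ => .one) (hpos (.declare i) (K ⊗ₖ L))
    rw [hf]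
    exact (mul_le_mul_of_nonneg_right hδ hone).trans
      (hQ.mul_pairing_one_le_of_declare hne _ i h)
  | alice I next ih =>
    rw [Protocol.pullback_kronecker_povm_alice] at h ⊢
    refine map_sum_nonneg_of_segment_subset f (continuous_margin Q c) hbound h (fun x => ?_)
      fun x hx => ih x.1 _ _ hx
    rw [← Protocol.pullback_kronecker_povm_alice]
    exact segment_subset_productFamilies_of_eq_right (hpos _ _) (hpos _ _)
      (Matrix.posSemidef_conjTranspose_mul_self K) (Matrix.posSemidef_conjTranspose_mul_self _)
      (Matrix.posSemidef_conjTranspose_mul_self L) (Protocol.sum_pullback_kronecker_povm _ K L)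
      ((next x.1).sum_pullback_kronecker_povm _ L)
  | bob I next ih =>
    rw [Protocol.pullback_kronecker_povm_bob] at h ⊢
    refine map_sum_nonneg_of_segment_subset f (continuous_margin Q c) hbound h (fun x => ?_)
      fun x hx => ih x.1 _ _ hx
    rw [← Protocol.pullback_kronecker_povm_bob]
    exact segment_subset_productFamilies_of_eq_left (hpos _ _) (hpos _ _)
      (Matrix.posSemidef_conjTranspose_mul_self K) (Matrix.posSemidef_conjTranspose_mul_self L)
      (Matrix.posSemidef_conjTranspose_mul_self _) (Protocol.sum_pullback_kronecker_povm _ K L)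
      ((next x.1).sum_pullback_kronecker_povm K _)

theorem IsProjectiveMeasurement.mul_pairing_one_povm_le [Nonempty ι]
    (hQ : IsProjectiveMeasurement Q) (hne : ∀ i, Q i ≠ 1)
    (hcQ : ∀ j, Q j ≠ 0 → c * Fintype.card (Fin dA × Fin dB) < (Q j).trace.re) {δ : ℝ}
    (hδ : δ ≤ c) (hbound : ∀ X ∈ productFamilies ι dA dB, margin Q c X = 0 →
      δ * pairing 1 X ≤ pairing (1 - Q) X) (P : Protocol ι dA dB) :
    δ * pairing 1 P.povm ≤ pairing (1 - Q) P.povm := by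
  obtain ⟨i⟩ := ‹Nonempty ι›
  obtain ⟨j, -, hj⟩ := hQ.exists_ne_and_ne_zero (hne i)
  have : Nonempty (Fin dA × Fin dB) := not_isEmpty_iff.mp fun _ => hj (Subsingleton.elim _ _)
  have hmargin : 0 < margin Q c P.povm :=
    margin_pos_of_sum_eq_smul_one hQ.posSemidef ⟨j, hj⟩ hcQ (s := 1)
      (by rw [P.sum_povm, one_smul]) (pairing_one_pos_of_sum_eq_one P.sum_povm)
  have hpull : pullback (1 ⊗ₖ 1) P.povm = P.povm := by
    rw [Matrix.one_kronecker_one, pullback_one]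
  simpa only [hpull] using hQ.mul_pairing_one_le hne hδ hbound P 1 1 (by rwa [hpull])

theorem IsAsymptoticLOCC.exists_mem_productFamilies [Nonempty ι] (hasymp : IsAsymptoticLOCC Q)
    (hQ : IsProjectiveMeasurement Q) (hne : ∀ i, Q i ≠ 1) (hc : 0 < c)
    (hcQ : ∀ j, Q j ≠ 0 → c * Fintype.card (Fin dA × Fin dB) < (Q j).trace.re) :
    ∃ X ∈ productFamilies ι dA dB, margin Q c X = 0 ∧ pairing 1 X = 1 ∧
      pairing (1 - Q) X = 0 := by
  by_contra! hnot
  obtain ⟨δ, hδ, hbound⟩ := hQ.exists_pos_mul_pairing_one_le fun X hX hmargin hone =>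
    (pairing_nonneg hQ.one_sub_posSemidef hX.1).lt_of_ne' (hnot X hX hmargin hone)
  have hbound' : ∀ X ∈ productFamilies ι dA dB, margin Q c X = 0 →
      min δ c * pairing 1 X ≤ pairing (1 - Q) X := fun X hX hmargin =>
    (mul_le_mul_of_nonneg_right (min_le_left δ c)
      (pairing_nonneg (R := 1) (fun _ => .one) hX.1)).trans (hbound X hX hmargin)
  obtain ⟨P, hP⟩ := hasymp
  have hlim : min δ c * pairing 1 Q ≤ pairing (1 - Q) Q :=
    le_of_tendsto_of_tendsto' ((((continuous_pairing 1).tendsto Q).comp hP).const_mul _)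
      (((continuous_pairing (1 - Q)).tendsto Q).comp hP)
      fun t => hQ.mul_pairing_one_povm_le hne hcQ (min_le_right δ c) hbound' (P t)
  have herror : pairing (1 - Q) Q = 0 := Finset.sum_eq_zero fun i _ => by
    rw [Pi.sub_apply, Pi.one_apply, mul_sub, mul_one, (hQ.idem i).eq, sub_self, Matrix.trace_zero,
      Complex.zero_re]
  have hweight : 0 < pairing 1 Q := by
    obtain ⟨i⟩ := ‹Nonempty ι›
    have : Nonempty (Fin dA × Fin dB) :=
      not_isEmpty_iff.mp fun _ => hne i (Subsingleton.elim _ _)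
    exact pairing_one_pos_of_sum_eq_one hQ.complete
  rw [herror] at hlim
  exact hlim.not_gt (mul_pos (lt_min hδ hc) hweight)

theorem IsAsymptoticLOCC.exists_commute_kronecker [Nonempty ι] (hasymp : IsAsymptoticLOCC Q)
    (hQ : IsProjectiveMeasurement Q) (hne : ∀ i, Q i ≠ 1) :
    ∃ (A : Matrix (Fin dA) (Fin dA) ℂ) (B : Matrix (Fin dB) (Fin dB) ℂ),
      A.IsHermitian ∧ B.IsHermitian ∧ (∀ a b : ℂ, A = a • 1 → B ≠ b • 1) ∧
      (∀ i, Commute (A ⊗ₖ B) (Q i)) ∧ ∀ i, Q i ≠ 0 → ((A ⊗ₖ B) * Q i).trace ≠ 0 := by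
  obtain ⟨i⟩ := ‹Nonempty ι›
  obtain ⟨j, -, hj⟩ := hQ.exists_ne_and_ne_zero (hne i)
  obtain ⟨c, hc, hcQ⟩ := exists_pos_mul_lt_re_trace hQ.posSemidef (Fintype.card (Fin dA × Fin dB))
  obtain ⟨X, hX, hmargin, hone, herror⟩ := hasymp.exists_mem_productFamilies hQ hne hc hcQ
  obtain ⟨hXpos, A, B, hA, hB, hsum⟩ := hX
  refine ⟨A, B, hA.1, hB.1, ?_, ?_, ?_⟩
  · rintro a b rfl rfl
    rw [Matrix.smul_kronecker, Matrix.kronecker_smul, Matrix.one_kronecker_one, smul_smul] at hsum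
    exact hmargin.not_gt (margin_pos_of_sum_eq_smul_one hQ.posSemidef ⟨j, hj⟩ hcQ hsum
      (hone ▸ one_pos))
  · rw [← hsum]
    exact hQ.commute_sum hXpos
      (trace_mul_eq_zero_of_pairing_eq_zero hQ.one_sub_posSemidef hXpos herror)
  · intro i hi htrace
    have hweight : 0 ≤ pairing (fun _ => Q i) X - c * pairing 1 X := hmargin ▸ margin_le hi
    rw [pairing_const, hsum, htrace, hone, Complex.zero_re, mul_one] at hweight
    linarith

end Error

section Splitting

theorem eq_of_kronecker_eq {R m n : Type*} [Semiring R] [IsRightCancelMulZero R] [Fintype n]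
    {X X' : Matrix m m R} {Y Y' : Matrix n n R} (h : X ⊗ₖ Y = X' ⊗ₖ Y')
    (htrace : Y.trace = Y'.trace) (hne : Y'.trace ≠ 0) : X = X' := by
  ext i j
  have hpartial : ∑ x, (X ⊗ₖ Y) (i, x) (j, x) = ∑ x, (X' ⊗ₖ Y') (i, x) (j, x) := by rw [h]
  simp only [Matrix.kronecker_apply, ← Finset.mul_sum] at hpartial
  change X i j * Y.trace = X' i j * Y'.trace at hpartial
  rw [htrace] at hpartial
  exact mul_right_cancel₀ hne hpartial

theorem commute_of_commute_kronecker {R m n : Type*} [CommRing R] [IsDomain R] [Fintype m]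
    [Fintype n] {A a : Matrix m m R} {B b : Matrix n n R} (h : Commute (A ⊗ₖ B) (a ⊗ₖ b))
    (hne : ((A ⊗ₖ B) * (a ⊗ₖ b)).trace ≠ 0) : Commute A a ∧ Commute B b := by
  rw [← Matrix.mul_kronecker_mul, Matrix.trace_kronecker] at hne
  rw [Commute, SemiconjBy, ← Matrix.mul_kronecker_mul, ← Matrix.mul_kronecker_mul] at h
  have hswap := congrArg (Matrix.submatrix · Prod.swap Prod.swap) h
  simp only [submatrix_swap_kronecker] at hswap
  have htraceA := Matrix.trace_mul_comm A a
  have htraceB := Matrix.trace_mul_comm B b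
  exact ⟨eq_of_kronecker_eq h htraceB (htraceB ▸ right_ne_zero_of_mul hne),
    eq_of_kronecker_eq hswap htraceA (htraceA ▸ left_ne_zero_of_mul hne)⟩

/-- All members of the family except possibly the one at `i₀` are product operators. -/
def IsProductExceptAt {ι : Type*} {dA dB : ℕ} (i₀ : ι) (M : ι → BipOp dA dB) : Prop :=
  ∀ i, i ≠ i₀ → ∃ a b, M i = a ⊗ₖ b

theorem IsProductExceptAt.pullback {ι : Type*} {dA dB dA' dB' : ℕ} {i₀ : ι}
    {M : ι → BipOp dA dB} (hM : IsProductExceptAt i₀ M) (K : Matrix (Fin dA) (Fin dA') ℂ)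
    (L : Matrix (Fin dB) (Fin dB') ℂ) : IsProductExceptAt i₀ (pullback (K ⊗ₖ L) M) := by
  intro i hi
  obtain ⟨a, b, hab⟩ := hM i hi
  refine ⟨Kᴴ * a * K, Lᴴ * b * L, ?_⟩
  rw [LOCC.pullback, hab, Matrix.conjTranspose_kronecker, ← Matrix.mul_kronecker_mul,
    ← Matrix.mul_kronecker_mul]

theorem IsProductExceptAt.swapParties {ι : Type*} {dA dB : ℕ} {i₀ : ι} {M : ι → BipOp dA dB}
    (hM : IsProductExceptAt i₀ M) : IsProductExceptAt i₀ (swapParties M) := by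
  intro i hi
  obtain ⟨a, b, hab⟩ := hM i hi
  exact ⟨b, a, by rw [LOCC.swapParties, hab, submatrix_swap_kronecker]⟩

variable {ι : Type} [DecidableEq ι] {dA dB : ℕ} {Q : ι → BipOp dA dB}

theorem IsFiniteLOCC.of_forall_pullback {N : ℕ} {p : Fin N → Matrix (Fin dA) (Fin dA) ℂ}
    (hp : IsProjectiveMeasurement p) {d : Fin N → ℕ} {V : ∀ k, Matrix (Fin dA) (Fin (d k)) ℂ}
    (hVp : ∀ k, V k * (V k)ᴴ = p k)
    (hcomm : ∀ k i, Commute (p k ⊗ₖ (1 : Matrix (Fin dB) (Fin dB) ℂ)) (Q i))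
    (h : ∀ k, IsFiniteLOCC (pullback (V k ⊗ₖ (1 : Matrix (Fin dB) (Fin dB) ℂ)) Q)) :
    IsFiniteLOCC Q := by
  have hVV : ∑ k, ((V k)ᴴ)ᴴ * (V k)ᴴ = 1 := by
    simp only [Matrix.conjTranspose_conjTranspose, hVp, hp.complete]
  convert IsFiniteLOCC.sum_pullback hVV h
  conv_lhs => rw [← hp.kronecker_one.sum_pullback_eq hcomm]
  refine Finset.sum_congr rfl fun k _ => ?_
  rw [pullback_pullback, ← Matrix.mul_kronecker_mul, hVp, one_mul]

variable [Fintype ι] {i₀ : ι}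

theorem IsProjectiveMeasurement.isFiniteLOCC_of_eq_one (hQ : IsProjectiveMeasurement Q) {i : ι}
    (hi : Q i = 1) : IsFiniteLOCC Q := by
  refine ⟨.declare i, funext fun j => ?_⟩
  simp only [Protocol.povm]
  split_ifs with hji
  · rw [hji, hi]
  · rw [← hQ.ortho hji, hi, mul_one]

theorem IsAsymptoticLOCC.exists_commute_factors (hasymp : IsAsymptoticLOCC Q)
    (hQ : IsProjectiveMeasurement Q) (hne : ∀ i, Q i ≠ 1) (hprod : IsProductExceptAt i₀ Q) :
    ∃ (A : Matrix (Fin dA) (Fin dA) ℂ) (B : Matrix (Fin dB) (Fin dB) ℂ),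
      A.IsHermitian ∧ B.IsHermitian ∧ (∀ a b : ℂ, A = a • 1 → B ≠ b • 1) ∧
      ∀ i, i ≠ i₀ → ∃ a b, Q i = a ⊗ₖ b ∧ Commute A a ∧ Commute B b := by
  have : Nonempty ι := ⟨i₀⟩
  obtain ⟨A, B, hA, hB, hscalar, hcomm, htrace⟩ := hasymp.exists_commute_kronecker hQ hne
  refine ⟨A, B, hA, hB, hscalar, fun i hi => ?_⟩
  by_cases hzero : Q i = 0
  · exact ⟨0, 0, by rw [hzero, Matrix.zero_kronecker], .zero_right A, .zero_right B⟩
  · obtain ⟨a, b, hab⟩ := hprod i hi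
    exact ⟨a, b, hab,
      commute_of_commute_kronecker (hab ▸ hcomm i) (hab ▸ htrace i hzero)⟩

theorem IsAsymptoticLOCC.isFiniteLOCC_of_commute (hasymp : IsAsymptoticLOCC Q)
    (hQ : IsProjectiveMeasurement Q) {A : Matrix (Fin dA) (Fin dA) ℂ} (hA : A.IsHermitian)
    (hscalar : ∀ c : ℂ, A ≠ c • 1)
    (hcomm : ∀ i, i ≠ i₀ → ∃ a b, Q i = a ⊗ₖ b ∧ Commute A a)
    (ih : ∀ d < dA, ∀ M : ι → BipOp d dB, IsAsymptoticLOCC M → IsProjectiveMeasurement M →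
      IsProductExceptAt i₀ M → IsFiniteLOCC M) : IsFiniteLOCC Q := by
  obtain ⟨p, hp, hpne, hpcomm⟩ := exists_isProjectiveMeasurement_of_not_scalar hA hscalar
  have hpQ k i : Commute (p k ⊗ₖ (1 : Matrix (Fin dB) (Fin dB) ℂ)) (Q i) := by
    refine hQ.commute_of_forall_ne (i₀ := i₀) (fun i hi => ?_) i
    obtain ⟨a, b, hab, hAa⟩ := hcomm i hi
    rw [hab, Commute, SemiconjBy, ← Matrix.mul_kronecker_mul, ← Matrix.mul_kronecker_mul,
      (hpcomm k a hAa).eq, one_mul, mul_one]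
  have hprod : IsProductExceptAt i₀ Q := fun i hi =>
    have ⟨a, b, hab, _⟩ := hcomm i hi
    ⟨a, b, hab⟩
  choose d hd V hV hVp using fun k => exists_isometry_of_isStarProjection (hp.isStarProjection k)
    (hpne k)
  let W k : Matrix (Fin dA × Fin dB) (Fin (d k) × Fin dB) ℂ := V k ⊗ₖ 1
  have hW k : (W k)ᴴ * W k = 1 := by
    rw [Matrix.conjTranspose_kronecker, ← Matrix.mul_kronecker_mul, hV, Matrix.conjTranspose_one,
      mul_one, Matrix.one_kronecker_one]
  have hWp k : W k * (W k)ᴴ = p k ⊗ₖ 1 := by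
    rw [Matrix.conjTranspose_kronecker, ← Matrix.mul_kronecker_mul, hVp, Matrix.conjTranspose_one,
      mul_one]
  exact .of_forall_pullback hp hVp hpQ fun k => ih (d k) (by simpa using hd k) _
    (hasymp.pullback (hV k)) (hQ.pullback (hW k) fun i => hWp k ▸ hpQ k i) (hprod.pullback _ _)

theorem IsAsymptoticLOCC.isFiniteLOCC (hasymp : IsAsymptoticLOCC Q)
    (hQ : IsProjectiveMeasurement Q) (hprod : IsProductExceptAt i₀ Q) : IsFiniteLOCC Q := by
  induction hN : dA + dB using Nat.strong_induction_on generalizing dA dB with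
  | _ N ih =>
  by_cases hone : ∃ i, Q i = 1
  · obtain ⟨i, hi⟩ := hone
    exact hQ.isFiniteLOCC_of_eq_one hi
  push Not at hone
  obtain ⟨A, B, hA, hB, hscalar, hcomm⟩ := hasymp.exists_commute_factors hQ hone hprod
  by_cases hAscalar : ∃ c : ℂ, A = c • 1
  · obtain ⟨c, hc⟩ := hAscalar
    rw [← swapParties_swapParties Q]
    refine (hasymp.swapParties.isFiniteLOCC_of_commute hQ.swapParties (i₀ := i₀) hB
      (fun b => hscalar c b hc) (fun i hi => ?_) fun d hd M hM hMproj hMprod =>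
        ih (d + dA) (by lia) hM hMproj hMprod rfl).swapParties
    obtain ⟨a, b, hab, -, hBb⟩ := hcomm i hi
    exact ⟨b, a, by rw [LOCC.swapParties, hab, submatrix_swap_kronecker], hBb⟩
  · push Not at hAscalar
    refine hasymp.isFiniteLOCC_of_commute hQ (i₀ := i₀) hA hAscalar (fun i hi => ?_)
      fun d hd M hM hMproj hMprod => ih (d + dB) (by lia) hM hMproj hMprod rfl
    obtain ⟨a, b, hab, hAa, -⟩ := hcomm i hi
    exact ⟨a, b, hab, hAa⟩

end Splitting

section Discrimination

variable {𝕜 ι n : Type*} [RCLike 𝕜] [Fintype ι] [DecidableEq ι] [Fintype n]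
  {M ρ : ι → Matrix n n 𝕜}

theorem mul_sum_of_mul_eq_ite (hMρ : ∀ i j, M j * ρ i = if j = i then ρ i else 0) (j : ι) :
    M j * ∑ i, ρ i = ρ j := by
  simp only [Finset.mul_sum, hMρ, Finset.sum_ite_eq, Finset.mem_univ, if_true]

variable [DecidableEq n]

theorem mul_eq_ite_of_trace_mul_eq_zero (hM : ∀ j, (M j).PosSemidef) (hsum : ∑ j, M j = 1)
    (hρ : ∀ i, (ρ i).PosSemidef) (h : ∀ i j, j ≠ i → (M j * ρ i).trace = 0) (i j : ι) :
    M j * ρ i = if j = i then ρ i else 0 := by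
  have hoff j (hj : j ≠ i) : M j * ρ i = 0 :=
    mul_eq_zero_of_trace_mul_eq_zero (hM j) (hρ i) (h i j hj)
  split_ifs with hji
  · calc M j * ρ i = ∑ k, M k * ρ i := by
          rw [Finset.sum_eq_single j (fun k _ hk => hoff k (hji ▸ hk)) (by simp)]
      _ = ρ i := by rw [← Finset.sum_mul, hsum, one_mul]
  · exact hoff j hji

theorem isProjectiveMeasurement_of_mul_eq_ite (hM : ∀ j, (M j).IsHermitian) (hsum : ∑ j, M j = 1)
    (hMρ : ∀ i j, M j * ρ i = if j = i then ρ i else 0) (hρ : IsUnit (∑ i, ρ i)) :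
    IsProjectiveMeasurement M := by
  refine ⟨⟨⟨fun j => ?_, fun i j hij => ?_⟩, hsum⟩, hM⟩ <;> apply hρ.mul_right_cancel
  · rw [mul_assoc, mul_sum_of_mul_eq_ite hMρ, hMρ, if_pos rfl]
  · change M i * M j * _ = _
    rw [mul_assoc, mul_sum_of_mul_eq_ite hMρ, hMρ, if_neg hij, zero_mul]

theorem isRangeProjection_of_mul_eq_ite {j : ι} (hM : (M j).IsHermitian)
    (hMρ : ∀ i j, M j * ρ i = if j = i then ρ i else 0) (hρ : IsUnit (∑ i, ρ i)) :
    IsRangeProjection (M j) (ρ j) where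
  isHermitian := hM
  mul_eq := by rw [hMρ, if_pos rfl]
  exists_eq_mul := by
    obtain ⟨S, hS⟩ := hρ.exists_right_inv
    exact ⟨S, by rw [← mul_sum_of_mul_eq_ite hMρ j, mul_assoc, hS, mul_one]⟩

end Discrimination

section Limits

theorem isClosed_posSemidef {𝕜 n : Type*} [RCLike 𝕜] [Finite n] :
    IsClosed {A : Matrix n n 𝕜 | A.PosSemidef} := by
  cases nonempty_fintype n
  simp only [Matrix.posSemidef_iff_dotProduct_mulVec, Matrix.IsHermitian, Set.ofPred_and,
    Set.ofPred_forall]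
  exact (isClosed_eq (by fun_prop) continuous_id).inter
    (isClosed_iInter fun x => isClosed_le continuous_const (by fun_prop))

variable {ι : Type} [DecidableEq ι] {dA dB : ℕ} {M : ι → BipOp dA dB}

theorem IsAsymptoticLOCC.mem_of_isClosed (hM : IsAsymptoticLOCC M) {s : Set (ι → BipOp dA dB)}
    (hs : IsClosed s) (h : ∀ P : Protocol ι dA dB, P.povm ∈ s) : M ∈ s := by
  obtain ⟨P, hP⟩ := hM
  exact hs.mem_of_tendsto hP (.of_forall fun t => h (P t))

theorem IsAsymptoticLOCC.sum_eq_one [Fintype ι] (hM : IsAsymptoticLOCC M) : ∑ i, M i = 1 :=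
  hM.mem_of_isClosed (s := {M | ∑ i, M i = 1}) (isClosed_eq (by fun_prop) continuous_const)
    Protocol.sum_povm

theorem IsAsymptoticLOCC.posSemidef (hM : IsAsymptoticLOCC M) (i : ι) : (M i).PosSemidef :=
  hM.mem_of_isClosed (s := (· i) ⁻¹' {A | A.PosSemidef})
    (isClosed_posSemidef.preimage (continuous_apply i)) fun P => P.posSemidef_povm i

end Limits

theorem isUnit_of_rank_eq_card {K n : Type*} [Field K] [Fintype n] [DecidableEq n]
    {A : Matrix n n K} (h : A.rank = Fintype.card n) : IsUnit A := by
  rw [← Matrix.linearIndependent_cols_iff_isUnit, linearIndependent_iff_card_eq_finrank_span,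
    Set.finrank, ← Matrix.rank_eq_finrank_span_cols, h]

end LOCC

theorem mainTheorem2 (dA dB n : ℕ) (ρ : Fin n → LOCC.BipOp dA dB)
    (hρ : LOCC.IsFullOrthogonalSet ρ) (i₀ : Fin n)
    (hprod : ∀ i, i ≠ i₀ → ∃ (σ : Matrix (Fin dA) (Fin dA) ℂ) (τ : Matrix (Fin dB) (Fin dB) ℂ),
      ρ i = σ ⊗ₖ τ)
    (hasymp : ∃ M : Fin n → LOCC.BipOp dA dB, LOCC.IsAsymptoticLOCC M ∧ LOCC.Discriminates M ρ) :
    ∃ M : Fin n → LOCC.BipOp dA dB, LOCC.IsFiniteLOCC M ∧ LOCC.Discriminates M ρ := by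
  obtain ⟨M, hM, hdisc⟩ := hasymp
  have hherm j : (M j).IsHermitian := (hM.posSemidef j).1
  have hunit : IsUnit (∑ i, ρ i) := LOCC.isUnit_of_rank_eq_card (by simpa using hρ.fullRank)
  have hMρ := LOCC.mul_eq_ite_of_trace_mul_eq_zero hM.posSemidef hM.sum_eq_one
    (fun i => (hρ.isState i).1) fun i j hji => by rw [hdisc, if_neg hji]
  have hproj : LOCC.IsProjectiveMeasurement M :=
    LOCC.isProjectiveMeasurement_of_mul_eq_ite hherm hM.sum_eq_one hMρ hunit
  have hMprod : LOCC.IsProductExceptAt i₀ M := fun i hi => by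
    obtain ⟨σ, τ, hστ⟩ := hprod i hi
    have hrange := LOCC.isRangeProjection_of_mul_eq_ite (hherm i) hMρ hunit
    rw [hστ] at hrange
    exact hrange.exists_eq_kronecker
  exact ⟨M, hM.isFiniteLOCC hproj hMprod, hdisc⟩
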